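/- **Model.** A dynamic network has $n\ge 1$ nodes and operates in synchronized rounds $0,1,2,\dots$. In round $t$ an adversary chooses a connected undirected graph $G(t)$ on the nodes; each node broadcasts an $O(b)$-bit message, chosen without knowing $G(t)$, and then receives the messages of its neighbours in $G(t)$ (and knows which neighbour sent which message). The network is *$T$-stable* ($T\ge 1$) if $G$ is constant on each block $iT,\dots,(i+1)T-1$ of rounds. In *$k$-token dissemination*, $k\le n$ tokens of $d\le b$ bits, with $b\ge 1$ and $b\ge\log_2 n$, are chosen by the adversary and placed at nodes before the first round, each token at one or more nodes; every node has to output all $k$ tokens and terminate (a terminated node sends nothing more). In a *centralized* algorithm the behaviour of a node may depend, besides on its identity, its own tokens and the messages it has received, on the initial distribution of the tokens (which node holds which tokens, not their contents), on all past topologies, and, if the algorithm is randomized, on a source of shared random bits, fresh ones being drawn in each round. The parameters $n,k,d,b,T$ are known, and local computation is unrestricted. The adversary is adaptive: it chooses $G(t)$ knowing the algorithm, the input, and the random bits of all rounds before $t$, but not those of round $t$. The algorithm is a *network coding* algorithm if every message, viewed as a vector over $\mathbb F_2$, is an $\mathbb F_2$-linear function of the tokens initially held and the messages received by its sender, with coefficients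 that may depend on the sender's identity, the round and the common knowledge above. **Statement.** All implied constants are absolute. 1. For all $n,k,d,b,T$ as above there is a randomized centralized network coding algorithm with $O(b)$-bit messages that, on every input and against every adaptive adversary that keeps the network connected and $T$-stable, always terminates with all tokens disseminated, and does so within $O(n)$ rounds with probability at least $1-2^{-n}$. This is order-optimal, so that the running time is $\Theta(n)$: if $1\le k\le n$, $d\ge 1$ and $T\ge 1$, then every randomized centralized algorithm (network coding or not, with messages of any size) that, on every input and against every such adversary, disseminates all tokens and terminates within $R$ rounds with probability at least $1-2^{-n}$ satisfies $R\ge n-1$. 2. For all $n,k,d,b,T$ as above there is a deterministic centralized network coding algorithm with $O(b)$-bit messages that, on every input and in every connected $T$-stable dynamic network, disseminates all tokens and terminates within $$O\!\left(\frac{\log n}{bT}\cdot n\cdot\min\{k,\tfrac nT\}+n\right)$$ rounds. -/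

import Mathlib

open MeasureTheory

namespace DynamicNetwork

/-- Strings of `m` bits, viewed as the vector space `F₂^m`. -/
abbrev Bits (m : ℕ) : Type := Fin m → ZMod 2

/-- The shared random bits that are drawn in one round (`s` of them; `s = 0`: none). -/
abbrev Coin (s : ℕ) : Type := Fin s → Bool

/-- An initial token distribution: which of the `k` tokens each node holds
(a token may be held by several nodes). The contents of the tokens are not part of it. -/
abbrev Placement (n k : ℕ) : Type := Fin n → Finset (Fin k)

/-- An input of `k`-token dissemination: `k` tokens of `d` bits each, and their initial
distribution, where every token is held by at least one node. -/
structure Input (n k d : ℕ) where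
  holds : Placement n k
  token : Fin k → Bits d
  held : ∀ i, ∃ v, i ∈ holds v

/-- The private information of a node after `t` rounds: the tokens it was given
(with `0` in the place of a token it does not hold), and, for each past round and each node `u`,
the message received from `u` in that round (`0` if `u` was not a neighbour; this is not confused
with a received zero message because the past topologies are known to the nodes). -/
abbrev View (n k d m t : ℕ) : Type := (Fin k → Bits d) × (Fin t → Fin n → Bits m)

/-- A centralized algorithm with `m`-bit messages and `s` shared random bits per round.
What a node does may depend on its identity, on its private information, and on the
common knowledge: the initial token distribution, the past topologies, and the shared random bits
drawn so far. Local computation is unrestricted.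

* `message t` is the message broadcast in round `t` (rounds are numbered `0, 1, …`): it may use
  the random bits of rounds `0, …, t` but only the topologies of rounds `0, …, t - 1`.
* `output t` is the decision after `t` rounds: `none` to go on, `some x` to terminate with
  output `x`. -/
structure CentralizedAlgorithm (n k d m s : ℕ) where
  message : (t : ℕ) → Placement n k → (Fin t → SimpleGraph (Fin n)) → (Fin (t + 1) → Coin s) →
    Fin n → View n k d m t → Bits m
  output : (t : ℕ) → Placement n k → (Fin t → SimpleGraph (Fin n)) → (Fin t → Coin s) →
    Fin n → View n k d m t → Option (Fin k → Bits d)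

/-- An adaptive adversary: it chooses the topology of round `t` knowing the random bits of all
earlier rounds, hence (algorithm and input being fixed beforehand) all past actions and the
current state of all nodes, but not the random bits of round `t`. -/
abbrev Adversary (n s : ℕ) : Type := (t : ℕ) → (Fin t → Coin s) → SimpleGraph (Fin n)

/-- The sequence of topologies that arises from the random bits `ω`. -/
def Adversary.graphs {n s : ℕ} (adv : Adversary n s) (ω : ℕ → Coin s) (t : ℕ) :
    SimpleGraph (Fin n) :=
  adv t (fun i => ω i)

/-- A dynamic network that is connected in every round and `T`-stable: the topology is constant
on each block `iT, …, (i + 1)T - 1` of `T` consecutive rounds. -/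
def IsStableNetwork {n : ℕ} (T : ℕ) (G : ℕ → SimpleGraph (Fin n)) : Prop :=
  (∀ t, (G t).Connected) ∧ ∀ t t', t / T = t' / T → G t = G t'

/-- The adversary always produces a connected `T`-stable dynamic network. -/
def Adversary.IsStable {n s : ℕ} (adv : Adversary n s) (T : ℕ) : Prop :=
  ∀ ω, IsStableNetwork T (adv.graphs ω)

namespace CentralizedAlgorithm

variable {n k d m s : ℕ}

/-- A network coding algorithm: every message is a linear function, over `F₂`, of the initial
tokens and the received messages of its sender. The coefficients may depend on the common
knowledge and on the identity of the sender. -/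
def IsNetworkCoding (A : CentralizedAlgorithm n k d m s) : Prop :=
  ∀ (t : ℕ) (p : Placement n k) (G : Fin t → SimpleGraph (Fin n)) (c : Fin (t + 1) → Coin s)
    (v : Fin n), IsLinearMap (ZMod 2) (A.message t p G c v)

open Classical in
/-- The private information of node `v` after `t` rounds on the topologies `G`, if
`sent τ u` is the message that `u` has broadcast in round `τ`. -/
noncomputable def view (I : Input n k d) (G : ℕ → SimpleGraph (Fin n)) {t : ℕ}
    (sent : Fin t → Fin n → Bits m) (v : Fin n) : View n k d m t :=
  (fun i => if i ∈ I.holds v then I.token i else 0,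
   fun τ u => if (G τ).Adj u v then sent τ u else 0)

/-- The decision of node `v` after `t` rounds. -/
noncomputable def decision (A : CentralizedAlgorithm n k d m s) (I : Input n k d) (G : ℕ → SimpleGraph (Fin n))
    (ω : ℕ → Coin s) {t : ℕ} (sent : Fin t → Fin n → Bits m) (v : Fin n) :
    Option (Fin k → Bits d) :=
  A.output t I.holds (fun i => G i) (fun i => ω i) v (view I G sent v)

/-- The execution up to the end of `t` rounds: the messages broadcast in these rounds, and for each
node `some x` if it has terminated with output `x`, and `none` if it has not terminated.
A node that has terminated is silent (it sends `0`) and keeps its output forever. -/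
noncomputable def run (A : CentralizedAlgorithm n k d m s) (I : Input n k d) (G : ℕ → SimpleGraph (Fin n))
    (ω : ℕ → Coin s) :
    (t : ℕ) → (Fin t → Fin n → Bits m) × (Fin n → Option (Fin k → Bits d))
  | 0 => (Fin.elim0, fun v => A.decision I G ω (t := 0) Fin.elim0 v)
  | t + 1 =>
    let sent := (A.run I G ω t).1
    let result := (A.run I G ω t).2
    let sent' : Fin (t + 1) → Fin n → Bits m := Fin.snoc sent fun v =>
      if (result v).isSome then 0
      else A.message t I.holds (fun i => G i) (fun i => ω i) v (view I G sent v)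
    (sent', fun v => if (result v).isSome then result v else A.decision I G ω sent' v)

/-- After `t` rounds all nodes have terminated, and each of them has output all `k` tokens. -/
def SolvedBy (A : CentralizedAlgorithm n k d m s) (I : Input n k d) (adv : Adversary n s)
    (ω : ℕ → Coin s) (t : ℕ) : Prop :=
  ∀ v, (A.run I (adv.graphs ω) ω t).2 v = some I.token

end CentralizedAlgorithm

/-- The law of the shared random bits: independent fair bits, `s` of them in each round. -/
noncomputable def coinMeasure (s : ℕ) : Measure (ℕ → Coin s) :=
  Measure.infinitePi fun _ : ℕ => (PMF.uniformOfFintype (Coin s)).toMeasure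

namespace CentralizedAlgorithm

variable {n k d m s : ℕ}

/-- On every input, against every `T`-stable adversary and for all outcomes of the random bits, all
nodes eventually terminate with all tokens. -/
def IsLasVegas (A : CentralizedAlgorithm n k d m s) (T : ℕ) : Prop :=
  ∀ (I : Input n k d) (adv : Adversary n s), adv.IsStable T →
    ∀ ω, ∃ t, A.SolvedBy I adv ω t

/-- On every input and against every `T`-stable adversary, with probability at least `p` all nodes
terminate with all tokens within `R` rounds. -/
def SolvesWithProb (A : CentralizedAlgorithm n k d m s) (T R : ℕ) (p : ℝ) : Prop :=
  ∀ (I : Input n k d) (adv : Adversary n s), adv.IsStable T →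
    p ≤ (coinMeasure s).real {ω | A.SolvedBy I adv ω R}

/-- On every input, against every `T`-stable adversary and for all outcomes of the random bits, all
nodes terminate with all tokens within `R` rounds. -/
def SolvesSurely (A : CentralizedAlgorithm n k d m s) (T R : ℕ) : Prop :=
  ∀ (I : Input n k d) (adv : Adversary n s), adv.IsStable T →
    ∀ ω, A.SolvedBy I adv ω R

end CentralizedAlgorithm

end DynamicNetwork

open DynamicNetwork

/-!
Random linear network coding over `K = GF(2^(3b))`, and its derandomization. Each node knows a
subspace of `K^k`, and sends a vector from it. The potential sums, over all functionals on `K^k`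
not known to all nodes, an exponential in the number of nodes that do not know it. Random vectors
decrease it by the factor `2^b` in expectation. The only functionals that fail to spread, whatever
connected graph the adversary chooses, are those lost by some sender, and the potential lost depends
only on the vectors sent. So the vectors can also be chosen deterministically, round by round and
without knowledge of the topology of the round, such that the potential decreases by this factor.
Hence the deterministic algorithm needs only `O(n)` rounds, for every `T`.
-/

/-! Tokens become elements of `K`, and a message is a `K`-combination of tokens, so it has `3b`
bits. What a node can decode is governed by a subspace of `K^k`, which is computable from the
placement, the past topologies and the coins alone. Hence all nodes know all the subspaces, can
coordinate their choices, and stop simultaneously once every subspace is everything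
(`Rule.run_algorithm`).

Progress is measured by functionals. If no node that knows `μ` sends a vector killed by `μ`, then
any connected graph has an edge carrying `μ` to a new node, which gains a factor `a⁻¹`. By a union
bound a random choice violates this for at most a fraction `n / |K|` of the choices. So the
potential shrinks by `ρ = n / |K| + a⁻¹` per round, on average (`sum_randomPotential_le`) or surely,
with a good choice (`potential_mixedRule_succ_le`). Below `1` it leaves no unsettled functional.
With `y = 2^b`, `|K| = y³` and `a = y²`, the potential starts at no more than `y^(5n)` and `ρ ≤
y⁻¹`, so `6n` rounds suffice. The term `n` of the deterministic bound already covers this.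

The lower bound puts all tokens at one end of a static path: the other end learns nothing before
round `n - 1`. -/

namespace DynamicNetwork

/-! ### The state of a network coding algorithm, and its potential -/

section Potential

open Finset Module

variable {K E ι : Type*} [Field K] [AddCommGroup E] [Module K E]

/-- A linear projection of `E` onto the subspace `V`. -/
noncomputable def projOnto (V : Submodule K E) : E →ₗ[K] E :=
  V.subtype ∘ₗ (LinearMap.exists_leftInverse_of_injective V.subtype V.ker_subtype).choose

theorem projOnto_mem (V : Submodule K E) (x : E) : projOnto V x ∈ V :=
  Subtype.property _

theorem projOnto_of_mem {V : Submodule K E} {x : E} (hx : x ∈ V) : projOnto V x = x := by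
  have h := (LinearMap.exists_leftInverse_of_injective V.subtype V.ker_subtype).choose_spec
  have h' := LinearMap.congr_fun h ⟨x, hx⟩
  simpa [projOnto] using congrArg Subtype.val h'

/-- If in a round node `u` sends the vector `x u`, then node `v`, which has known the subspace
`V v`, knows afterwards the span of `V v` and of the vectors sent by its neighbours. -/
def step (V : ι → Submodule K E) (x : ι → E) (G : SimpleGraph ι) (v : ι) : Submodule K E :=
  V v ⊔ Submodule.span K {y | ∃ u, G.Adj u v ∧ x u = y}

theorem le_step (V : ι → Submodule K E) (x : ι → E) (G : SimpleGraph ι) (v : ι) :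
    V v ≤ step V x G v :=
  le_sup_left

theorem mem_step (V : ι → Submodule K E) (x : ι → E) {G : SimpleGraph ι} {u v : ι}
    (h : G.Adj u v) : x u ∈ step V x G v :=
  Submodule.mem_sup_right (Submodule.subset_span ⟨u, h, rfl⟩)

/-- Used for counting: a nonzero functional vanishes on exactly the fraction `1 / |K|` of all
vectors. -/
theorem card_ker_mul_card {F : Type*} [AddCommGroup F] [Module K F] {ν : F →ₗ[K] K}
    (hν : ν ≠ 0) : Nat.card (LinearMap.ker ν) * Nat.card K = Nat.card F := by
  rw [Submodule.card_eq_card_quotient_mul_card (LinearMap.ker ν),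
    Nat.card_congr (ν.quotKerEquivOfSurjective (LinearMap.surjective hν)).toEquiv]

variable [Fintype ι]

open Classical in
/-- The nodes that can distinguish `μ` from the zero functional. -/
noncomputable def knowers (V : ι → Submodule K E) (μ : Dual K E) : Finset ι :=
  {v | ∃ x ∈ V v, μ x ≠ 0}

theorem mem_knowers {V : ι → Submodule K E} {μ : Dual K E} {v : ι} :
    v ∈ knowers V μ ↔ ∃ x ∈ V v, μ x ≠ 0 := by
  simp [knowers]

theorem knowers_mono {V W : ι → Submodule K E} (h : V ≤ W) (μ : Dual K E) :
    knowers V μ ⊆ knowers W μ := fun v hv => by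
  obtain ⟨x, hx, hμ⟩ := mem_knowers.1 hv
  exact mem_knowers.2 ⟨x, h v hx, hμ⟩

theorem knowers_nonempty {V : ι → Submodule K E} (hV : ⨆ v, V v = ⊤) {μ : Dual K E}
    (hμ : μ ≠ 0) : (knowers V μ).Nonempty := by
  by_contra hne
  have hle : ⨆ v, V v ≤ LinearMap.ker μ := by
    refine iSup_le fun v x hx => ?_
    by_contra hx0
    exact hne ⟨v, mem_knowers.2 ⟨x, hx, hx0⟩⟩
  rw [hV, top_le_iff, LinearMap.ker_eq_top] at hle
  exact hμ hle

theorem exists_adj_of_mem_of_notMem {G : SimpleGraph ι} (hG : G.Connected) {S : Finset ι}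
    (hS : S.Nonempty) (hS' : S ≠ univ) : ∃ u ∈ S, ∃ v ∉ S, G.Adj u v := by
  obtain ⟨u, hu⟩ := hS
  obtain ⟨v, hv⟩ : ∃ v, v ∉ S := by simpa [eq_univ_iff_forall] using hS'
  obtain ⟨w⟩ := hG.preconnected u v
  obtain ⟨e, -, h1, h2⟩ := w.exists_boundary_dart (S : Set ι) hu hv
  exact ⟨e.fst, h1, e.snd, h2, e.adj⟩

variable [Finite K] [Finite E]

noncomputable local instance : Fintype (Dual K E) :=
  have : Finite (Dual K E) := DFunLike.finite _
  Fintype.ofFinite _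

open Classical in
/-- The nonzero functionals that are not known to all nodes. -/
noncomputable def unsettled (V : ι → Submodule K E) : Finset (Dual K E) :=
  {μ | μ ≠ 0 ∧ knowers V μ ≠ univ}

theorem mem_unsettled {V : ι → Submodule K E} {μ : Dual K E} :
    μ ∈ unsettled V ↔ μ ≠ 0 ∧ knowers V μ ≠ univ := by
  simp [unsettled]

variable [DecidableEq ι]

/-- Every functional that is not yet known to all nodes counts as `a` to the number of nodes that
do not know it. -/
noncomputable def potential (a : ℝ) (V : ι → Submodule K E) : ℝ :=
  ∑ μ ∈ unsettled V, a ^ #(knowers V μ)ᶜ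

open Classical in
/-- The part of the potential due to functionals that vanish on the vector sent by some node that
knows them. -/
noncomputable def lostPotential (a : ℝ) (V : ι → Submodule K E) (x : ι → E) : ℝ :=
  ∑ μ ∈ unsettled V with ∃ u ∈ knowers V μ, μ (x u) = 0, a ^ #(knowers V μ)ᶜ

theorem potential_nonneg {a : ℝ} (ha : 0 ≤ a) (V : ι → Submodule K E) : 0 ≤ potential a V :=
  sum_nonneg fun _ _ => pow_nonneg ha _

/-- A proper subspace is annihilated by some nonzero functional. That functional is unsettled and
alone contributes at least `1`, because `1 ≤ a`. -/
theorem eq_top_of_potential_lt_one {a : ℝ} (ha : 1 ≤ a) {V : ι → Submodule K E}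
    (h : potential a V < 1) (v : ι) : V v = ⊤ := by
  classical
  by_contra hv
  obtain ⟨μ, hμ0, hμ⟩ := Submodule.exists_dual_map_eq_bot_of_lt_top (lt_top_iff_ne_top.2 hv)
    inferInstance
  have hmem : μ ∈ unsettled V := by
    refine mem_unsettled.2 ⟨hμ0, fun hall => ?_⟩
    obtain ⟨x, hx, hx0⟩ := mem_knowers.1 (hall ▸ mem_univ v)
    exact hx0 ((Submodule.mem_bot K).1 (hμ ▸ Submodule.mem_map_of_mem (f := μ) hx))
  have h1 : a ^ #(knowers V μ)ᶜ ≤ potential a V :=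
    single_le_sum (f := fun μ => a ^ #(knowers V μ)ᶜ) (fun _ _ => by positivity) hmem
  linarith [one_le_pow₀ ha (n := #(knowers V μ)ᶜ)]

theorem potential_le {a : ℝ} (ha : 1 ≤ a) (V : ι → Submodule K E) :
    potential a V ≤ Nat.card E * a ^ Fintype.card ι := by
  classical
  have hcard : Fintype.card (Dual K E) = Nat.card E := by
    rw [← Nat.card_eq_fintype_card, Module.natCard_eq_pow_finrank (K := K),
      Module.natCard_eq_pow_finrank (K := K) (V := E), Subspace.dual_finrank_eq]
  calc potential a V ≤ ∑ μ ∈ unsettled V, a ^ Fintype.card ι :=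
        sum_le_sum fun μ _ => pow_le_pow_right₀ ha (card_le_univ _)
    _ ≤ ∑ μ : Dual K E, a ^ Fintype.card ι :=
        sum_le_sum_of_subset_of_nonneg (subset_univ _) fun _ _ _ => by positivity
    _ = Nat.card E * a ^ Fintype.card ι := by simp [hcard]

/-- In every connected graph, the functionals that are not lost become known to a new node. -/
theorem potential_step_le {a : ℝ} (ha : 1 ≤ a) {V : ι → Submodule K E} (hV : ⨆ v, V v = ⊤)
    (x : ι → E) {G : SimpleGraph ι} (hG : G.Connected) :
    potential a (step V x G) ≤ lostPotential a V x + a⁻¹ * potential a V := by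
  classical
  have ha0 : 0 < a := by linarith
  have hmono := knowers_mono (le_step V x G)
  have hsub : unsettled (step V x G) ⊆ unsettled V := fun μ hμ => by
    rw [mem_unsettled] at hμ ⊢
    exact ⟨hμ.1, fun h => hμ.2 (univ_subset_iff.1 (h ▸ hmono μ))⟩
  calc potential a (step V x G)
      ≤ ∑ μ ∈ unsettled (step V x G),
          ((if ∃ u ∈ knowers V μ, μ (x u) = 0 then a ^ #(knowers V μ)ᶜ else 0) +
            a⁻¹ * a ^ #(knowers V μ)ᶜ) := by
        refine sum_le_sum fun μ hμ => ?_
        have hμ' := mem_unsettled.1 (hsub hμ)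
        split_ifs with hlost
        -- A lost functional may fail to spread, but its knowers never decrease.
        · have h1 : a ^ #(knowers (step V x G) μ)ᶜ ≤ a ^ #(knowers V μ)ᶜ :=
            pow_le_pow_right₀ ha (card_le_card (compl_subset_compl.2 (hmono μ)))
          have h2 : 0 ≤ a⁻¹ * a ^ #(knowers V μ)ᶜ := by positivity
          linarith
        · push Not at hlost
          -- Connectedness gives an edge leaving the set of knowers; what its inner end sends
          -- teaches `μ` to the outer end.
          obtain ⟨u, hu, v, hv, huv⟩ :=
            exists_adj_of_mem_of_notMem hG (knowers_nonempty hV hμ'.1) hμ'.2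
          have hv' : v ∈ knowers (step V x G) μ :=
            mem_knowers.2 ⟨x u, mem_step V x huv, hlost u hu⟩
          have hlt : #(knowers (step V x G) μ)ᶜ < #(knowers V μ)ᶜ :=
            card_lt_card (compl_ssubset_compl.2 ⟨hmono μ, fun h => hv (h hv')⟩)
          rw [zero_add, ← div_eq_inv_mul, le_div_iff₀ ha0, ← pow_succ]
          exact pow_le_pow_right₀ ha hlt
    _ ≤ ∑ μ ∈ unsettled V,
          ((if ∃ u ∈ knowers V μ, μ (x u) = 0 then a ^ #(knowers V μ)ᶜ else 0) +
            a⁻¹ * a ^ #(knowers V μ)ᶜ) :=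
        sum_le_sum_of_subset_of_nonneg hsub fun _ _ _ => by positivity
    _ = lostPotential a V x + a⁻¹ * potential a V := by
        rw [sum_add_distrib, ← sum_filter, ← mul_sum]; rfl

/-- If all nodes send random vectors from their subspaces, then on average only a fraction of
`|ι| / |K|` of the potential is lost. -/
theorem sum_lostPotential_le [Fintype E] {a : ℝ} (ha : 0 ≤ a) (V : ι → Submodule K E) :
    ∑ r : ι → E, lostPotential a V (fun u => projOnto (V u) (r u)) ≤
      Fintype.card (ι → E) * (Fintype.card ι / Nat.card K * potential a V) := by
  classical
  have hK : (0 : ℝ) < Nat.card K := by exact_mod_cast Nat.card_pos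
  have hcount : ∀ μ : Dual K E,
      (#{r : ι → E | ∃ u ∈ knowers V μ, μ (projOnto (V u) (r u)) = 0} : ℝ) ≤
        Fintype.card (ι → E) * (Fintype.card ι / Nat.card K) := fun μ => by
    have h1 : ∀ u ∈ knowers V μ, (#{r : ι → E | μ (projOnto (V u) (r u)) = 0} : ℝ) =
        Fintype.card (ι → E) / Nat.card K := fun u hu => by
      obtain ⟨x, hx, hx0⟩ := mem_knowers.1 hu
      -- Viewed on the space of all families `r`, the condition is the vanishing of one functional.
      -- It is nonzero because the projection fixes a witness `x ∈ V u`.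
      have hν : μ ∘ₗ projOnto (V u) ∘ₗ LinearMap.proj (R := K) (φ := fun _ : ι => E) u ≠ 0 :=
        fun h => hx0 (by
          have := LinearMap.congr_fun h (fun _ => x)
          simpa [projOnto_of_mem hx] using this)
      rw [eq_div_iff hK.ne', ← Nat.card_eq_fintype_card, ← card_ker_mul_card hν, Nat.cast_mul]
      congr 2
      rw [Nat.card_eq_fintype_card, ← Fintype.card_subtype]
      exact Fintype.card_congr (Equiv.refl _)
    calc (#{r : ι → E | ∃ u ∈ knowers V μ, μ (projOnto (V u) (r u)) = 0} : ℝ)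
        -- Union bound over the nodes that know `μ`.
        ≤ #((knowers V μ).biUnion fun u => {r : ι → E | μ (projOnto (V u) (r u)) = 0}) := by
          gcongr
          intro r; simp
      _ ≤ ∑ u ∈ knowers V μ, (#{r : ι → E | μ (projOnto (V u) (r u)) = 0} : ℝ) := by
          exact_mod_cast card_biUnion_le
      _ = #(knowers V μ) * (Fintype.card (ι → E) / Nat.card K) := by
          rw [sum_congr rfl h1, sum_const, nsmul_eq_mul]
      _ ≤ Fintype.card ι * (Fintype.card (ι → E) / Nat.card K) := by
          gcongr
          exact card_le_univ _
      _ = _ := by ring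
  calc ∑ r : ι → E, lostPotential a V (fun u => projOnto (V u) (r u))
      = ∑ μ ∈ unsettled V, ∑ r : ι → E,
          if ∃ u ∈ knowers V μ, μ (projOnto (V u) (r u)) = 0 then a ^ #(knowers V μ)ᶜ else 0 := by
        rw [sum_comm]
        exact sum_congr rfl fun r _ => sum_filter _ _
    _ = ∑ μ ∈ unsettled V,
          (#{r : ι → E | ∃ u ∈ knowers V μ, μ (projOnto (V u) (r u)) = 0} : ℝ) *
            a ^ #(knowers V μ)ᶜ := by
        refine sum_congr rfl fun μ _ => ?_
        rw [← sum_filter, sum_const, nsmul_eq_mul]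
    _ ≤ ∑ μ ∈ unsettled V, Fintype.card (ι → E) * (Fintype.card ι / Nat.card K) *
            a ^ #(knowers V μ)ᶜ :=
        sum_le_sum fun μ _ => mul_le_mul_of_nonneg_right (hcount μ) (by positivity)
    _ = _ := by rw [← mul_sum, mul_assoc]; rfl

/-- There are vectors to send for which at most the average potential is lost. -/
theorem exists_lostPotential_le {a : ℝ} (ha : 0 ≤ a) (V : ι → Submodule K E) :
    ∃ r : ι → E, lostPotential a V (fun u => projOnto (V u) (r u)) ≤
      Fintype.card ι / Nat.card K * potential a V := by
  have := Fintype.ofFinite E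
  by_contra! h
  have := sum_lt_sum_of_nonempty (s := (univ : Finset (ι → E))) univ_nonempty fun r _ => h r
  rw [sum_const, nsmul_eq_mul, card_univ] at this
  exact absurd (sum_lostPotential_le ha V) (not_le.2 this)

end Potential

/-! ### From a choice of vectors to an algorithm -/

section Coding

variable {n k d m s : ℕ} {K : Type*} [Field K]

/-- A rule that proposes, from the round, the subspaces of `K^k` known by the nodes, and the random
bits of the round, a vector for each node. -/
abbrev Rule (n k s : ℕ) (K : Type*) [Field K] : Type _ :=
  ℕ → (Fin n → Submodule K (Fin k → K)) → Coin s → Fin n → Fin k → K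

/-- The vector that node `u` sends if it knows the subspace `V u`: the projection to `V u` of the
vector that the rule proposes. -/
noncomputable def Rule.vector (σ : Rule n k s K) (t : ℕ) (V : Fin n → Submodule K (Fin k → K))
    (c : Coin s) (u : Fin n) : Fin k → K :=
  projOnto (V u) (σ t V c u)

/-- The subspace of `K^k` known by each node before the first round. -/
def initialKnowledge (K : Type*) [Field K] (p : Placement n k) (v : Fin n) :
    Submodule K (Fin k → K) :=
  Submodule.span K {x | ∃ i ∈ p v, Pi.single i 1 = x}

/-- The subspace of `K^k` known by each node after `t` rounds. -/
noncomputable def Rule.knowledge (σ : Rule n k s K) (p : Placement n k)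
    (G : ℕ → SimpleGraph (Fin n)) (ω : ℕ → Coin s) : ℕ → Fin n → Submodule K (Fin k → K)
  | 0 => initialKnowledge K p
  | t + 1 => step (σ.knowledge p G ω t) (σ.vector t (σ.knowledge p G ω t) (ω t)) (G t)

/-- The vector that node `u` sends in round `t`. -/
noncomputable def Rule.sent (σ : Rule n k s K) (p : Placement n k)
    (G : ℕ → SimpleGraph (Fin n)) (ω : ℕ → Coin s) (t : ℕ) : Fin n → Fin k → K :=
  σ.vector t (σ.knowledge p G ω t) (ω t)

/-- Causality: only the past matters. This is why a node may compute with finite histories continued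
arbitrarily by `extend`. -/
theorem Rule.knowledge_congr (σ : Rule n k s K) (p : Placement n k)
    {G G' : ℕ → SimpleGraph (Fin n)} {ω ω' : ℕ → Coin s} {t : ℕ} (hG : ∀ i < t, G i = G' i)
    (hω : ∀ i < t, ω i = ω' i) : σ.knowledge p G ω t = σ.knowledge p G' ω' t := by
  induction t with
  | zero => rfl
  | succ t ih =>
    rw [knowledge, knowledge, ih (fun i hi => hG i (by omega)) (fun i hi => hω i (by omega)),
      hG t (by omega), hω t (by omega)]

/-- The asymmetry is that of the model: a message may use the coins of its own round, but not the
topology of that round. -/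
theorem Rule.sent_congr (σ : Rule n k s K) (p : Placement n k)
    {G G' : ℕ → SimpleGraph (Fin n)} {ω ω' : ℕ → Coin s} {t : ℕ} (hG : ∀ i < t, G i = G' i)
    (hω : ∀ i < t + 1, ω i = ω' i) : σ.sent p G ω t = σ.sent p G' ω' t := by
  rw [sent, sent, σ.knowledge_congr p hG (fun i hi => hω i (by omega)), hω t (by omega)]

theorem Rule.knowledge_mono (σ : Rule n k s K) (p : Placement n k)
    (G : ℕ → SimpleGraph (Fin n)) (ω : ℕ → Coin s) : Monotone (σ.knowledge p G ω) :=
  monotone_nat_of_le_succ fun _ => le_step _ _ _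

theorem Rule.iSup_knowledge (σ : Rule n k s K) (I : Input n k d) (G : ℕ → SimpleGraph (Fin n))
    (ω : ℕ → Coin s) (t : ℕ) : ⨆ v, σ.knowledge I.holds G ω t v = ⊤ := by
  classical
  rw [eq_top_iff, ← (Pi.basisFun K (Fin k)).span_eq, Submodule.span_le]
  rintro _ ⟨i, rfl⟩
  rw [Pi.basisFun_apply]
  obtain ⟨v, hv⟩ := I.held i
  exact Submodule.mem_iSup_of_mem v (σ.knowledge_mono I.holds G ω (Nat.zero_le t) v
    (Submodule.subset_span ⟨i, hv, rfl⟩))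

theorem Rule.knowledge_le (σ : Rule n k s K) (p : Placement n k) (G : ℕ → SimpleGraph (Fin n))
    (ω : ℕ → Coin s) (v : Fin n) (D : Submodule K (Fin k → K)) {t : ℕ}
    (h0 : ∀ i ∈ p v, Pi.single i 1 ∈ D)
    (h1 : ∀ τ < t, ∀ u, (G τ).Adj u v → σ.sent p G ω τ u ∈ D) :
    σ.knowledge p G ω t v ≤ D := by
  induction t with
  | zero =>
    refine Submodule.span_le.2 ?_
    rintro _ ⟨i, hi, rfl⟩
    exact h0 i hi
  | succ t ih =>
    refine sup_le (ih fun τ hτ => h1 τ (by omega)) (Submodule.span_le.2 ?_)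
    rintro _ ⟨u, hu, rfl⟩
    exact h1 t (by omega) u hu

variable [Algebra (ZMod 2) K]

/-- The linear combination with coefficients `x` of the tokens, which are embedded into `K`. -/
def combine (emb : Bits d →ₗ[ZMod 2] K) (x : Fin k → K) (tok : Fin k → Bits d) : K :=
  ∑ i, x i * emb (tok i)

variable (enc : K ≃ₗ[ZMod 2] Bits m) (emb : Bits d →ₗ[ZMod 2] K)

/-- The private information of node `v` after `t` rounds if every node sends the combination of the
tokens with the coefficients given by the rule. -/
noncomputable def Rule.codedView (σ : Rule n k s K) (p : Placement n k)
    (G : ℕ → SimpleGraph (Fin n)) (ω : ℕ → Coin s) (t : ℕ) (v : Fin n) (tok : Fin k → Bits d) :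
    View n k d m t :=
  open Classical in
  (fun i => if i ∈ p v then tok i else 0,
   fun τ u => if (G τ).Adj u v then enc (combine emb (σ.sent p G ω τ u) tok) else 0)

theorem Rule.codedView_congr (σ : Rule n k s K) (p : Placement n k)
    {G G' : ℕ → SimpleGraph (Fin n)} {ω ω' : ℕ → Coin s} {t : ℕ} (hG : ∀ i < t, G i = G' i)
    (hω : ∀ i < t, ω i = ω' i) (v : Fin n) :
    (σ.codedView enc emb p G ω t v : _ → View n k d m t) = σ.codedView enc emb p G' ω' t v := by
  funext tok
  refine Prod.ext rfl ?_
  funext τ u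
  simp only [codedView]
  rw [hG τ τ.2, σ.sent_congr p (fun i hi => hG i (by omega)) (fun i hi => hω i (by omega))]

/-- The coefficient vectors `x` such that the combination of the tokens with coefficients `x` is an
`F₂`-linear function of `view tok`. -/
def decodable {X : Type*} [AddCommGroup X] [Module (ZMod 2) X] (view : (Fin k → Bits d) → X) :
    Submodule K (Fin k → K) where
  carrier := {x | ∃ L : X →ₗ[ZMod 2] Bits m, ∀ tok, L (view tok) = enc (combine emb x tok)}
  zero_mem' := ⟨0, fun tok => by simp [combine]⟩
  add_mem' := by
    rintro x y ⟨L, hL⟩ ⟨L', hL'⟩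
    exact ⟨L + L', fun tok => by
      simp [hL, hL', combine, add_mul, Finset.sum_add_distrib]⟩
  smul_mem' := by
    rintro a x ⟨L, hL⟩
    -- Multiplication by a scalar of `K` is `F₂`-linear, so it can be carried out on bit strings
    -- through `enc`.
    refine ⟨enc.toLinearMap ∘ₗ LinearMap.mulLeft (ZMod 2) a ∘ₗ enc.symm.toLinearMap ∘ₗ L,
      fun tok => ?_⟩
    simp [hL, combine, mul_assoc]

/-- The decodable vectors form a `K`-subspace, so generators suffice: unit vectors of held tokens
are read off the first component of the view, received vectors off the second. -/
theorem Rule.knowledge_le_decodable (σ : Rule n k s K) (p : Placement n k)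
    (G : ℕ → SimpleGraph (Fin n)) (ω : ℕ → Coin s) (t : ℕ) (v : Fin n) :
    σ.knowledge p G ω t v ≤ decodable enc emb (σ.codedView enc emb p G ω t v) := by
  classical
  refine σ.knowledge_le p G ω v _ (fun i hi => ?_) fun τ hτ u hu => ?_
  · refine ⟨enc.toLinearMap ∘ₗ emb ∘ₗ LinearMap.proj i ∘ₗ LinearMap.fst _ _ _, fun tok => ?_⟩
    simp [codedView, hi, combine, Pi.single_apply]
  · refine ⟨LinearMap.proj u ∘ₗ LinearMap.proj (⟨τ, hτ⟩ : Fin t) ∘ₗ LinearMap.snd _ _ _,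
      fun tok => ?_⟩
    simp [codedView, hu]

/-- A node that knows all of `K^k` can determine the tokens. -/
theorem Rule.codedView_injective (hemb : Function.Injective emb) (σ : Rule n k s K)
    {p : Placement n k} {G : ℕ → SimpleGraph (Fin n)} {ω : ℕ → Coin s} {t : ℕ} {v : Fin n}
    (h : σ.knowledge p G ω t v = ⊤) :
    Function.Injective (σ.codedView enc emb p G ω t v) := by
  classical
  intro tok tok' heq
  funext i
  obtain ⟨L, hL⟩ := σ.knowledge_le_decodable enc emb p G ω t v
    (h ▸ Submodule.mem_top : Pi.single i 1 ∈ σ.knowledge p G ω t v)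
  have := (hL tok).symm.trans ((congrArg L heq).trans (hL tok'))
  exact hemb (by simpa [combine, Pi.single_apply] using this)

/-- Continue a finite sequence by a constant. -/
def extend {α : Type*} (a : α) {t : ℕ} (f : Fin t → α) (i : ℕ) : α :=
  if h : i < t then f ⟨i, h⟩ else a

theorem extend_apply {α : Type*} (a : α) {t : ℕ} (f : ℕ → α) {i : ℕ} (h : i < t) :
    extend a (fun j : Fin t => f j) i = f i := by
  simp [extend, h]

/-- The linear function of its private information that node `v` sends in round `t`. -/
noncomputable def Rule.encoder (σ : Rule n k s K) (p : Placement n k)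
    (G : ℕ → SimpleGraph (Fin n)) (ω : ℕ → Coin s) (t : ℕ) (v : Fin n) :
    View n k d m t →ₗ[ZMod 2] Bits m :=
  (σ.knowledge_le_decodable enc emb p G ω t v
    (projOnto_mem _ (σ t (σ.knowledge p G ω t) (ω t) v))).choose

theorem Rule.encoder_apply (σ : Rule n k s K) (p : Placement n k)
    (G : ℕ → SimpleGraph (Fin n)) (ω : ℕ → Coin s) (t : ℕ) (v : Fin n) (tok : Fin k → Bits d) :
    σ.encoder enc emb p G ω t v (σ.codedView enc emb p G ω t v tok) =
      enc (combine emb (σ.sent p G ω t v) tok) :=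
  (σ.knowledge_le_decodable enc emb p G ω t v
    (projOnto_mem _ (σ t (σ.knowledge p G ω t) (ω t) v))).choose_spec tok

open Classical in
/-- The algorithm in which every node sends the combination of the tokens with the coefficients
given by the rule, until all nodes know all of `K^k`; then all nodes decode and terminate. -/
noncomputable def Rule.algorithm (σ : Rule n k s K) : CentralizedAlgorithm n k d m s where
  message t p G c v :=
    σ.encoder enc emb p (extend ⊥ G) (extend (fun _ => false) c) t v
  output t p G c v x :=
    if ∀ w, σ.knowledge p (extend ⊥ G) (extend (fun _ => false) c) t w = ⊤ then
      some (Function.invFun (σ.codedView enc emb p (extend ⊥ G) (extend (fun _ => false) c) t v) x)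
    else none

theorem Rule.algorithm_isNetworkCoding (σ : Rule n k s K) :
    (σ.algorithm enc emb).IsNetworkCoding :=
  fun _ _ _ _ _ => LinearMap.isLinear _

theorem Rule.message_algorithm (σ : Rule n k s K) (p : Placement n k)
    (G : ℕ → SimpleGraph (Fin n)) (ω : ℕ → Coin s) (t : ℕ) (v : Fin n) (tok : Fin k → Bits d) :
    (σ.algorithm enc emb).message t p (fun i => G i) (fun i => ω i) v
      (σ.codedView enc emb p G ω t v tok) = enc (combine emb (σ.sent p G ω t v) tok) := by
  have hG : ∀ i < t, G i = extend ⊥ (fun j : Fin t => G j) i :=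
    fun i hi => (extend_apply _ G hi).symm
  have hω : ∀ i < t + 1, ω i = extend (fun _ => false) (fun j : Fin (t + 1) => ω j) i :=
    fun i hi => (extend_apply _ ω hi).symm
  rw [σ.codedView_congr enc emb p hG (fun i hi => hω i (by omega)), σ.sent_congr p hG hω]
  exact σ.encoder_apply enc emb p _ _ t v tok

open Classical in
theorem Rule.output_algorithm (hemb : Function.Injective emb) (σ : Rule n k s K)
    (p : Placement n k) (G : ℕ → SimpleGraph (Fin n)) (ω : ℕ → Coin s) (t : ℕ) (v : Fin n)
    (tok : Fin k → Bits d) :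
    (σ.algorithm enc emb).output t p (fun i => G i) (fun i => ω i) v
      (σ.codedView enc emb p G ω t v tok) =
        if ∀ w, σ.knowledge p G ω t w = ⊤ then some tok else none := by
  have hG : ∀ i < t, G i = extend ⊥ (fun j : Fin t => G j) i :=
    fun i hi => (extend_apply _ G hi).symm
  have hω : ∀ i < t, ω i = extend (fun _ => false) (fun j : Fin t => ω j) i :=
    fun i hi => (extend_apply _ ω hi).symm
  rw [σ.codedView_congr enc emb p hG hω, σ.knowledge_congr p hG hω]
  simp only [algorithm]
  split_ifs with h
  · rw [Function.leftInverse_invFun (σ.codedView_injective enc emb hemb (h v)) tok]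
  · rfl

/-- The invariant of the execution. Termination is simultaneous, so no node falls silent while
others still rely on its messages; after termination nothing about messages is needed. -/
theorem Rule.run_algorithm (hemb : Function.Injective emb) (σ : Rule n k s K) (I : Input n k d)
    (G : ℕ → SimpleGraph (Fin n)) (ω : ℕ → Coin s) (t : ℕ) :
    (¬ (∀ w, σ.knowledge I.holds G ω t w = ⊤) ∧
      (∀ v, ((σ.algorithm enc emb).run I G ω t).2 v = none) ∧
      ∀ τ u, ((σ.algorithm enc emb).run I G ω t).1 τ u =
        enc (combine emb (σ.sent I.holds G ω τ u) I.token)) ∨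
    ((∀ w, σ.knowledge I.holds G ω t w = ⊤) ∧
      ∀ v, ((σ.algorithm enc emb).run I G ω t).2 v = some I.token) := by
  classical
  have hview : ∀ (t : ℕ) (sent : Fin t → Fin n → Bits m),
      (∀ τ u, sent τ u = enc (combine emb (σ.sent I.holds G ω τ u) I.token)) → ∀ v,
      CentralizedAlgorithm.view I G sent v = σ.codedView enc emb I.holds G ω t v I.token := by
    intro t sent h v
    refine Prod.ext rfl ?_
    funext τ u
    simp only [CentralizedAlgorithm.view, codedView, h]
  have hdec : ∀ (t : ℕ) (sent : Fin t → Fin n → Bits m),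
      (∀ τ u, sent τ u = enc (combine emb (σ.sent I.holds G ω τ u) I.token)) → ∀ v,
      (σ.algorithm enc emb).decision I G ω sent v =
        if ∀ w, σ.knowledge I.holds G ω t w = ⊤ then some I.token else none := by
    intro t sent h v
    rw [CentralizedAlgorithm.decision, hview t sent h]
    exact σ.output_algorithm enc emb hemb I.holds G ω t v I.token
  induction t with
  | zero =>
    have h0 := hdec 0 Fin.elim0 (fun τ => τ.elim0)
    by_cases h : ∀ w, σ.knowledge I.holds G ω 0 w = ⊤
    · exact .inr ⟨h, fun v => by exact (h0 v).trans (if_pos h)⟩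
    · exact .inl ⟨h, fun v => by exact (h0 v).trans (if_neg h), fun τ => τ.elim0⟩
  | succ t ih =>
    rcases ih with ⟨-, hnone, hsent⟩ | ⟨htop, hsome⟩
    · have hsent' : ∀ τ u, ((σ.algorithm enc emb).run I G ω (t + 1)).1 τ u =
          enc (combine emb (σ.sent I.holds G ω τ u) I.token) := by
        intro τ u
        rw [CentralizedAlgorithm.run]
        refine Fin.lastCases ?_ (fun τ => ?_) τ
        · simp only [Fin.snoc_last, hnone, Option.isSome_none, Bool.false_eq_true, if_false]
          rw [hview t _ hsent]
          exact σ.message_algorithm enc emb I.holds G ω t u I.token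
        · simp only [Fin.snoc_castSucc]
          exact hsent τ u
      have hres : ∀ v, ((σ.algorithm enc emb).run I G ω (t + 1)).2 v =
          if ∀ w, σ.knowledge I.holds G ω (t + 1) w = ⊤ then some I.token else none := by
        intro v
        rw [← hdec (t + 1) _ hsent' v]
        conv_lhs => rw [CentralizedAlgorithm.run]
        simp only [hnone, Option.isSome_none, Bool.false_eq_true, if_false]
        rw [CentralizedAlgorithm.run]
        simp only [hnone, Option.isSome_none, Bool.false_eq_true, if_false]
      by_cases h : ∀ w, σ.knowledge I.holds G ω (t + 1) w = ⊤
      · exact .inr ⟨h, fun v => by rw [hres, if_pos h]⟩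
      · exact .inl ⟨h, fun v => by rw [hres, if_neg h], hsent'⟩
    · refine .inr ⟨fun w => ?_, fun v => ?_⟩
      · exact top_le_iff.1 (htop w ▸ σ.knowledge_mono I.holds G ω (Nat.le_succ t) w)
      · rw [CentralizedAlgorithm.run]
        simp [hsome]

theorem Rule.solvedBy_algorithm (hemb : Function.Injective emb) (σ : Rule n k s K)
    (I : Input n k d) (adv : Adversary n s) (ω : ℕ → Coin s) {t : ℕ}
    (h : ∀ w, σ.knowledge I.holds (adv.graphs ω) ω t w = ⊤) :
    (σ.algorithm enc emb).SolvedBy I adv ω t := by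
  rcases σ.run_algorithm enc emb hemb I (adv.graphs ω) ω t with h' | h'
  · exact absurd h h'.1
  · exact h'.2

end Coding

/-! ### Random rounds, followed by rounds in which little potential is lost -/

section Rules

open Finset

variable {n k d s : ℕ} {K : Type*} [Field K] [Finite K]

/-- In the first `R` rounds the vectors proposed are read off the random bits (by `f`). Afterwards
they are chosen such that not more than the average potential is lost; this takes no knowledge of
the topology of the round. -/
noncomputable def mixedRule (a : ℝ) (ha : 0 ≤ a) (R : ℕ) (f : Coin s → Fin n → Fin k → K) :
    Rule n k s K :=
  fun t V c => if t < R then f c else (exists_lostPotential_le ha V).choose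

variable {a ρ : ℝ} (ha : 0 ≤ a) {R : ℕ} {f : Coin s → Fin n → Fin k → K}

theorem potential_mixedRule_succ_le (ha1 : 1 ≤ a) (hρ : n / Nat.card K + a⁻¹ ≤ ρ)
    (I : Input n k d) {G : ℕ → SimpleGraph (Fin n)} (hG : ∀ t, (G t).Connected) (ω : ℕ → Coin s)
    {t : ℕ} (ht : R ≤ t) :
    potential a ((mixedRule a ha R f).knowledge I.holds G ω (t + 1)) ≤
      ρ * potential a ((mixedRule a ha R f).knowledge I.holds G ω t) := by
  set V := (mixedRule a ha R f).knowledge I.holds G ω t with hV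
  have h1 := potential_step_le ha1 ((mixedRule a ha R f).iSup_knowledge I G ω t)
    ((mixedRule a ha R f).vector t V (ω t)) (hG t)
  have h2 : lostPotential a V ((mixedRule a ha R f).vector t V (ω t)) ≤
      n / Nat.card K * potential a V := by
    have h := (exists_lostPotential_le ha V).choose_spec.trans_eq
      (congrArg (fun N : ℕ => (N : ℝ) / Nat.card K * potential a V) (Fintype.card_fin n))
    unfold Rule.vector mixedRule
    simpa only [not_lt.2 ht, if_false] using h
  have h3 := mul_le_mul_of_nonneg_right hρ (potential_nonneg ha V)
  rw [Rule.knowledge, ← hV]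
  rw [← hV] at h1
  linarith

theorem potential_mixedRule_add_le (ha1 : 1 ≤ a) (hρ : n / Nat.card K + a⁻¹ ≤ ρ)
    (I : Input n k d) {G : ℕ → SimpleGraph (Fin n)} (hG : ∀ t, (G t).Connected) (ω : ℕ → Coin s)
    (j : ℕ) :
    potential a ((mixedRule a ha R f).knowledge I.holds G ω (R + j)) ≤
      ρ ^ j * (Nat.card K ^ k * a ^ n) := by
  have hρ0 : 0 ≤ ρ := le_trans (by positivity) hρ
  induction j with
  | zero =>
    refine (potential_le ha1 _).trans_eq ?_
    simp [Nat.card_fun]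
  | succ j ih =>
    calc _ ≤ ρ * potential a ((mixedRule a ha R f).knowledge I.holds G ω (R + j)) :=
          potential_mixedRule_succ_le ha ha1 hρ I hG ω (Nat.le_add_right R j)
      _ ≤ ρ * (ρ ^ j * (Nat.card K ^ k * a ^ n)) := by gcongr
      _ = _ := by ring

/-- The bound `i ≤ t` is inclusive since the graph of round `t` depends on the coins before round
`t` only. -/
theorem Adversary.graphs_congr (adv : Adversary n s) {ω ω' : ℕ → Coin s} {t : ℕ}
    (h : ∀ i < t, ω i = ω' i) {i : ℕ} (hi : i ≤ t) : adv.graphs ω i = adv.graphs ω' i := by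
  unfold graphs
  congr 1
  funext j
  exact h j (by omega)

/-- The potential after `t` rounds, as a function of the random bits of these rounds. -/
noncomputable def randomPotential (a : ℝ) (σ : Rule n k s K) (I : Input n k d)
    (adv : Adversary n s) {t : ℕ} (c : Fin t → Coin s) : ℝ :=
  potential a (σ.knowledge I.holds (adv.graphs (extend (fun _ => false) c))
    (extend (fun _ => false) c) t)

/-- An expectation, left unnormalized as a sum over coin histories. For a fixed history `c` the
graph of round `t` is fixed too, since the adversary does not see the next coins `x`; so averaging
over `x` bounds the loss. -/
theorem sum_randomPotential_le (ha1 : 1 ≤ a) (hρ : n / Nat.card K + a⁻¹ ≤ ρ)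
    (hf : Function.Bijective f) (I : Input n k d) {adv : Adversary n s} {T : ℕ}
    (hadv : adv.IsStable T) {t : ℕ} (ht : t ≤ R) :
    ∑ c : Fin t → Coin s, randomPotential a (mixedRule a ha R f) I adv c ≤
      (Fintype.card (Coin s) * ρ) ^ t * (Nat.card K ^ k * a ^ n) := by
  have := Fintype.ofFinite K
  have hρ0 : 0 ≤ ρ := le_trans (by positivity) hρ
  induction t with
  | zero =>
    rw [Fintype.sum_unique, pow_zero, one_mul]
    refine (potential_le ha1 _).trans_eq ?_
    simp
  | succ t ih =>
    have hstep : ∀ c : Fin t → Coin s,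
        ∑ x : Coin s, randomPotential a (mixedRule a ha R f) I adv
          (Fin.snoc (α := fun _ => Coin s) c x) ≤
        Fintype.card (Coin s) * ρ * randomPotential a (mixedRule a ha R f) I adv c := by
      intro c
      set ω := extend (fun _ => false) c
      set V := (mixedRule a ha R f).knowledge I.holds (adv.graphs ω) ω t with hV
      have hx : ∀ x : Coin s, randomPotential a (mixedRule a ha R f) I adv
          (Fin.snoc (α := fun _ => Coin s) c x) ≤
            lostPotential a V (fun u => projOnto (V u) (f x u)) + a⁻¹ * potential a V := by
        intro x
        set ω' := extend (fun _ => false) (Fin.snoc (α := fun _ => Coin s) c x) with hω'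
        have hω : ∀ i < t, ω' i = ω i := fun i hi => by
          simp [ω', ω, extend, hi, Nat.lt_succ_of_lt hi, Fin.snoc]
        have hωt : ω' t = x := by simp [ω', extend, Fin.snoc]
        have hgr := fun i (hi : i ≤ t) => adv.graphs_congr hω hi
        have h1 := potential_step_le ha1 ((mixedRule a ha R f).iSup_knowledge I (adv.graphs ω) ω t)
          (fun u => projOnto (V u) (f x u)) ((hadv ω).1 t)
        rw [randomPotential, ← hω', Rule.knowledge,
          Rule.knowledge_congr _ I.holds (fun i hi => hgr i hi.le) hω, hgr t le_rfl, hωt, ← hV]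
        rw [← hV] at h1
        convert h1 using 3
        funext u
        simp [Rule.vector, mixedRule, Nat.lt_of_succ_le ht]
      have hcard : Fintype.card (Coin s) = Fintype.card (Fin n → Fin k → K) :=
        Fintype.card_of_bijective hf
      calc _ ≤ ∑ x : Coin s,
            (lostPotential a V (fun u => projOnto (V u) (f x u)) + a⁻¹ * potential a V) :=
            sum_le_sum fun x _ => hx x
        -- Bijectivity of `f` makes uniform coins a uniform family of vectors.
        _ = ∑ r : Fin n → Fin k → K, lostPotential a V (fun u => projOnto (V u) (r u)) +
              Fintype.card (Coin s) * (a⁻¹ * potential a V) := by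
            rw [sum_add_distrib, sum_const, nsmul_eq_mul, card_univ,
              hf.sum_comp fun r => lostPotential a V (fun u => projOnto (V u) (r u))]
        _ ≤ Fintype.card (Coin s) * (n / Nat.card K * potential a V) +
              Fintype.card (Coin s) * (a⁻¹ * potential a V) := by
            have := sum_lostPotential_le ha V
            rw [← hcard, Fintype.card_fin] at this
            gcongr
        _ = Fintype.card (Coin s) * (n / Nat.card K + a⁻¹) * potential a V := by ring
        _ ≤ Fintype.card (Coin s) * ρ * potential a V := by
            have := potential_nonneg ha V
            gcongr
    rw [← (Fin.snocEquiv fun _ => Coin s).sum_comp, Fintype.sum_prod_type_right]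
    calc _ ≤ ∑ c : Fin t → Coin s,
          Fintype.card (Coin s) * ρ * randomPotential a (mixedRule a ha R f) I adv c :=
          sum_le_sum fun c _ => hstep c
      _ ≤ Fintype.card (Coin s) * ρ *
          ((Fintype.card (Coin s) * ρ) ^ t * (Nat.card K ^ k * a ^ n)) := by
          rw [← mul_sum]
          have := ih (by omega)
          gcongr
      _ = _ := by ring

end Rules

/-! ### Events that depend on finitely many random bits -/

section Probability

open Finset

instance (s : ℕ) : IsProbabilityMeasure (coinMeasure s) := by
  unfold coinMeasure; infer_instance

theorem coinMeasure_real_cylinder {s t : ℕ} (c : Fin t → Coin s) :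
    (coinMeasure s).real {ω | ∀ i : Fin t, ω i = c i} = ((Fintype.card (Coin s) : ℝ) ^ t)⁻¹ := by
  have hset : {ω : ℕ → Coin s | ∀ i : Fin t, ω i = c i} =
      Set.pi (range t) fun i => {extend (fun _ => false) c i} := by
    ext ω
    simp only [Set.mem_ofPred_eq, Set.mem_pi, Set.mem_singleton_iff, mem_coe, mem_range]
    refine ⟨fun h i hi => ?_, fun h i => ?_⟩
    · simpa [extend, hi] using h ⟨i, hi⟩
    · simpa [extend] using h i i.2
  rw [hset, Measure.real, coinMeasure, Measure.infinitePi_pi _ fun i _ => measurableSet_singleton _]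
  simp only [PMF.toMeasure_apply_singleton _ _ (measurableSet_singleton _),
    PMF.uniformOfFintype_apply, prod_const, card_range]
  simp

-- Covering by cylinders gives the upper bound by subadditivity alone.
open Classical in
theorem coinMeasure_real_le {s t : ℕ} (B : (Fin t → Coin s) → Prop) :
    (coinMeasure s).real {ω | B fun i => ω i} ≤
      #{c | B c} * ((Fintype.card (Coin s) : ℝ) ^ t)⁻¹ := by
  calc (coinMeasure s).real {ω | B fun i => ω i}
      ≤ (coinMeasure s).real (⋃ c ∈ ({c | B c} : Finset (Fin t → Coin s)),
          {ω | ∀ i : Fin t, ω i = c i}) := by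
        refine measureReal_mono (fun ω hω => ?_) (measure_ne_top _ _)
        simp only [Set.mem_iUnion]
        exact ⟨fun i => ω i, by simpa using hω, fun i => rfl⟩
    _ ≤ ∑ c with B c, (coinMeasure s).real {ω | ∀ i : Fin t, ω i = c i} :=
        measureReal_biUnion_finset_le _ _
    _ = _ := by
        simp only [coinMeasure_real_cylinder, sum_const, nsmul_eq_mul]

end Probability

/-! ### Running time and success probability -/

section Algorithms

open Finset

variable {n k d m s : ℕ} {K : Type*} [Field K] [Finite K] [Algebra (ZMod 2) K]
  {enc : K ≃ₗ[ZMod 2] Bits m} {emb : Bits d →ₗ[ZMod 2] K} {a ρ : ℝ} (ha : 0 ≤ a) {R : ℕ}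
  {f : Coin s → Fin n → Fin k → K}

theorem solvedBy_mixedRule (hemb : Function.Injective emb) (ha1 : 1 ≤ a)
    (hρ : n / Nat.card K + a⁻¹ ≤ ρ) {j : ℕ} (hj : ρ ^ j * (Nat.card K ^ k * a ^ n) < 1)
    (I : Input n k d) {adv : Adversary n s} {T : ℕ} (hadv : adv.IsStable T) (ω : ℕ → Coin s) :
    ((mixedRule a ha R f).algorithm enc emb).SolvedBy I adv ω (R + j) :=
  Rule.solvedBy_algorithm enc emb hemb _ I adv ω <| eq_top_of_potential_lt_one ha1 <|
    (potential_mixedRule_add_le ha ha1 hρ I (hadv ω).1 ω j).trans_lt hj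

theorem solvesWithProb_mixedRule (hemb : Function.Injective emb) (ha1 : 1 ≤ a)
    (hρ : n / Nat.card K + a⁻¹ ≤ ρ) (hf : Function.Bijective f) (T : ℕ) :
    ((mixedRule a ha R f).algorithm enc emb).SolvesWithProb T R
      (1 - ρ ^ R * (Nat.card K ^ k * a ^ n)) := by
  classical
  intro I adv hadv
  set A : CentralizedAlgorithm n k d m s := (mixedRule a ha R f).algorithm enc emb
  set B : (Fin R → Coin s) → Prop := fun c =>
    1 ≤ randomPotential a (mixedRule a ha R f) I adv c
  have hN : (0 : ℝ) < (Fintype.card (Coin s) : ℝ) ^ R := by positivity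
  have hbad : (coinMeasure s).real {ω | B fun i => ω i} ≤
      ρ ^ R * (Nat.card K ^ k * a ^ n) := by
    have h1 : (#{c | B c} : ℝ) ≤
        (Fintype.card (Coin s) * ρ) ^ R * (Nat.card K ^ k * a ^ n) := by
      -- Markov's inequality: each bad history has potential at least `1`.
      calc (#{c | B c} : ℝ) = ∑ c with B c, (1 : ℝ) := by simp
        _ ≤ ∑ c with B c, randomPotential a (mixedRule a ha R f) I adv c :=
            sum_le_sum fun c hc => (mem_filter.1 hc).2
        _ ≤ ∑ c, randomPotential a (mixedRule a ha R f) I adv c :=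
            sum_le_sum_of_subset_of_nonneg (subset_univ _) fun c _ _ => potential_nonneg ha _
        _ ≤ _ := sum_randomPotential_le ha ha1 hρ hf I hadv le_rfl
    refine (coinMeasure_real_le B).trans ?_
    rw [← div_eq_mul_inv, div_le_iff₀ hN]
    refine h1.trans_eq ?_
    ring
  -- Success and bad event cover everything, so subadditivity suffices and success need not be shown
  -- measurable.
  have hcover : {ω | A.SolvedBy I adv ω R} ∪ {ω | B fun i => ω i} = Set.univ := by
    refine Set.eq_univ_of_forall fun ω => ?_
    by_cases hω : B fun i => ω i
    · exact .inr hω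
    · refine .inl (Rule.solvedBy_algorithm enc emb hemb _ I adv ω ?_)
      refine eq_top_of_potential_lt_one ha1 (lt_of_eq_of_lt ?_ (not_le.1 hω))
      have hext : ∀ i < R, ω i = extend (fun _ => false) (fun j : Fin R => ω j) i :=
        fun i hi => (extend_apply _ ω hi).symm
      rw [randomPotential, Rule.knowledge_congr _ I.holds
        (fun i hi => adv.graphs_congr hext hi.le) hext]
  have := measureReal_union_le (μ := coinMeasure s) {ω | A.SolvedBy I adv ω R}
    {ω | B fun i => ω i}
  rw [hcover, probReal_univ] at this
  linarith

end Algorithms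

/-! ### The lower bound -/

section LowerBound

variable {n k d m s : ℕ}

theorem CentralizedAlgorithm.run_congr (A : CentralizedAlgorithm n k d m s) (I : Input n k d)
    (G : ℕ → SimpleGraph (Fin n)) {ω ω' : ℕ → Coin s} {t : ℕ} (h : ∀ i < t, ω i = ω' i) :
    A.run I G ω t = A.run I G ω' t := by
  induction t with
  | zero =>
    have h0 : (fun i : Fin 0 => ω i) = fun i : Fin 0 => ω' i := funext fun i => i.elim0
    simp only [run, decision, h0]
  | succ t ih =>
    have ht : (fun i : Fin (t + 1) => ω i) = fun i : Fin (t + 1) => ω' i :=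
      funext fun i => h i i.2
    simp only [run, decision, ht, ih fun i hi => h i (by omega)]

/-- The input in which one node holds all tokens. -/
def concentratedInput (v₀ : Fin n) (tok : Fin k → Bits d) : Input n k d where
  holds v := if v = v₀ then Finset.univ else ∅
  token := tok
  held i := ⟨v₀, by simp⟩

/-- On a path with all tokens at its first node, what a node at distance more than `t` from it does
in the first `t` rounds does not depend on the contents of the tokens. -/
theorem CentralizedAlgorithm.run_path_eq (A : CentralizedAlgorithm n k d m s) {v₀ : Fin n}
    (hv₀ : v₀.val = 0) (tok tok' : Fin k → Bits d) (ω : ℕ → Coin s) (t : ℕ) :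
    (∀ (τ : Fin t) (u : Fin n), τ.val < u →
      (A.run (concentratedInput v₀ tok) (fun _ => SimpleGraph.pathGraph n) ω t).1 τ u =
        (A.run (concentratedInput v₀ tok') (fun _ => SimpleGraph.pathGraph n) ω t).1 τ u) ∧
    ∀ v : Fin n, t < v.val →
      (A.run (concentratedInput v₀ tok) (fun _ => SimpleGraph.pathGraph n) ω t).2 v =
        (A.run (concentratedInput v₀ tok') (fun _ => SimpleGraph.pathGraph n) ω t).2 v := by
  have hview : ∀ (t : ℕ) (sent sent' : Fin t → Fin n → Bits m),
      (∀ (τ : Fin t) (u : Fin n), τ.val < u → sent τ u = sent' τ u) → ∀ v : Fin n, t < v.val →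
      view (concentratedInput v₀ tok) (fun _ => SimpleGraph.pathGraph n) sent v =
        view (concentratedInput v₀ tok') (fun _ => SimpleGraph.pathGraph n) sent' v := by
    intro t sent sent' h v hv
    have hne : v ≠ v₀ := fun h => by rw [h] at hv; omega
    refine Prod.ext ?_ ?_
    · funext i
      simp [view, concentratedInput, hne]
    · funext τ u
      simp only [view]
      split_ifs with hadj
      · refine h τ u ?_
        have := τ.2
        rcases SimpleGraph.pathGraph_adj.1 hadj with h1 | h1 <;> omega
      · rfl
  have hdec : ∀ (t : ℕ) (sent sent' : Fin t → Fin n → Bits m),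
      (∀ (τ : Fin t) (u : Fin n), τ.val < u → sent τ u = sent' τ u) → ∀ v : Fin n, t < v.val →
      A.decision (concentratedInput v₀ tok) (fun _ => SimpleGraph.pathGraph n) ω sent v =
        A.decision (concentratedInput v₀ tok') (fun _ => SimpleGraph.pathGraph n) ω sent' v := by
    intro t sent sent' h v hv
    rw [decision, decision, hview t sent sent' h v hv]
    rfl
  induction t with
  | zero =>
    exact ⟨fun τ => τ.elim0, fun v hv => hdec 0 _ _ (fun τ => τ.elim0) v hv⟩
  | succ t ih =>
    have hsent : ∀ (τ : Fin (t + 1)) (u : Fin n), τ.val < u →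
        (A.run (concentratedInput v₀ tok) (fun _ => SimpleGraph.pathGraph n) ω (t + 1)).1 τ u =
        (A.run (concentratedInput v₀ tok') (fun _ => SimpleGraph.pathGraph n) ω (t + 1)).1 τ u := by
      intro τ u
      simp only [run]
      refine Fin.lastCases (fun hu => ?_) (fun τ hu => ?_) τ
      · simp only [Fin.snoc_last]
        rw [ih.2 u hu, hview t _ _ ih.1 u hu]
        rfl
      · simp only [Fin.snoc_castSucc]
        exact ih.1 τ u hu
    refine ⟨hsent, fun v hv => ?_⟩
    have h1 := hdec (t + 1) _ _ hsent v hv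
    have h2 := ih.2 v (by omega)
    simp only [run] at h1 ⊢
    rw [h1, h2]

/-- With the same coins, the last node of the path gives the same answer for all-zero and all-one
tokens. The two success events are therefore disjoint, yet each would have probability at least
`3/4`. -/
theorem CentralizedAlgorithm.SolvesWithProb.le_succ {T R : ℕ} {A : CentralizedAlgorithm n k d m s}
    (hk : 1 ≤ k) (hd : 1 ≤ d) (hA : A.SolvesWithProb T R (1 - 2⁻¹ ^ n)) : n ≤ R + 1 := by
  by_contra! hR
  obtain ⟨n', rfl⟩ : ∃ n', n = n' + 1 := ⟨n - 1, by omega⟩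
  set adv : Adversary (n' + 1) s := fun _ _ => SimpleGraph.pathGraph (n' + 1)
  have hadv : adv.IsStable T := fun ω => ⟨fun _ => SimpleGraph.pathGraph_connected n',
    fun _ _ _ => rfl⟩
  set E : (Fin k → Bits d) → Set (ℕ → Coin s) :=
    fun tok => {ω | A.SolvedBy (concentratedInput 0 tok) adv ω R} with hE
  -- Additivity over the disjoint union needs measurability, which holds because the event depends
  -- on the coins of `R` rounds only.
  have hmeas : ∀ tok, MeasurableSet (E tok) := by
    intro tok
    have hpre : E tok = (fun (ω : ℕ → Coin s) (i : Fin R) => ω i) ⁻¹'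
        {c | extend (fun _ => false) c ∈ E tok} := by
      ext ω
      have hext : ∀ i < R, ω i = extend (fun _ => false) (fun j : Fin R => ω j) i :=
        fun i hi => (extend_apply _ ω hi).symm
      have := A.run_congr (concentratedInput 0 tok) (fun _ => SimpleGraph.pathGraph (n' + 1)) hext
      exact forall_congr' fun v => by
        change (A.run _ (fun _ => SimpleGraph.pathGraph (n' + 1)) _ R).2 v = _ ↔
          (A.run _ (fun _ => SimpleGraph.pathGraph (n' + 1)) _ R).2 v = _
        rw [this]
    rw [hpre]
    exact (measurable_pi_lambda _ fun i => measurable_pi_apply _) (Set.toFinite _).measurableSet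
  have hdisj : Disjoint (E 0) (E 1) := by
    refine Set.disjoint_left.2 fun ω h0 h1 => ?_
    have heq := (A.run_path_eq (v₀ := (0 : Fin (n' + 1))) rfl 0 1 ω R).2 (Fin.last n')
      (by simp; omega)
    have h := Option.some_injective _ ((h0 (Fin.last n')).symm.trans (heq.trans (h1 (Fin.last n'))))
    have := congrFun (congrFun h ⟨0, hk⟩) ⟨0, hd⟩
    simp [concentratedInput] at this
  have h0 := hA (concentratedInput 0 0) adv hadv
  have h1 := hA (concentratedInput 0 1) adv hadv
  have hle : (coinMeasure s).real (E 0) + (coinMeasure s).real (E 1) ≤ 1 := by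
    rw [← measureReal_union hdisj (hmeas 1)]
    exact measureReal_le_one
  -- The negated claim `R + 1 < n` forces at least two nodes.
  have hpow : (2⁻¹ : ℝ) ^ (n' + 1) ≤ 2⁻¹ ^ 2 :=
    pow_le_pow_of_le_one (by norm_num) (by norm_num) (by omega)
  norm_num at hpow h0 h1
  linarith

end LowerBound

/-! ### The choice of the parameters -/

section Parameters

variable {n k d b : ℕ}

theorem exists_embedding (hb : 1 ≤ b) (hd : d ≤ b) :
    ∃ (_ : GaloisField 2 (3 * b) ≃ₗ[ZMod 2] Bits (3 * b))
      (emb : Bits d →ₗ[ZMod 2] GaloisField 2 (3 * b)), Function.Injective emb := by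
  let enc : GaloisField 2 (3 * b) ≃ₗ[ZMod 2] Bits (3 * b) :=
    LinearEquiv.ofFinrankEq _ _ (by rw [GaloisField.finrank 2 (by omega), Module.finrank_fin_fun])
  have hcast : Function.Injective (Fin.castLE (by omega : d ≤ 3 * b)) := Fin.castLE_injective _
  refine ⟨enc, enc.symm.toLinearMap ∘ₗ
    Function.ExtendByZero.linearMap (ZMod 2) (Fin.castLE (by omega : d ≤ 3 * b)),
    enc.symm.injective.comp fun x y h => funext fun i => ?_⟩
  have := congrFun h (Fin.castLE (by omega) i)
  simpa [Function.ExtendByZero.linearMap_apply, hcast.extend_apply] using this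

theorem natCard_galoisField (hb : 1 ≤ b) :
    (Nat.card (GaloisField 2 (3 * b)) : ℝ) = (2 ^ b) ^ 3 := by
  rw [GaloisField.card 2 _ (by omega), ← pow_mul, mul_comm b 3]
  norm_num

theorem le_two_pow (hn : 1 ≤ n) (hnb : Real.logb 2 n ≤ b) : (n : ℝ) ≤ 2 ^ b := by
  have := (Real.logb_le_iff_le_rpow one_lt_two (by exact_mod_cast hn)).1 hnb
  exact_mod_cast this

theorem two_le_two_pow (hb : 1 ≤ b) : (2 : ℝ) ≤ 2 ^ b := by
  simpa using pow_le_pow_right₀ (one_le_two (α := ℝ)) hb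

/-- With `y = 2^b ≥ n`, both terms are at most `y⁻²`, and `2 ≤ y` absorbs the factor `2`. This is
what the exponents `3` for `|K|` and `2` for `a` are for. -/
theorem decay_le (hb : 1 ≤ b) (hnb : (n : ℝ) ≤ 2 ^ b) :
    n / (Nat.card (GaloisField 2 (3 * b)) : ℝ) + ((2 ^ b : ℝ) ^ 2)⁻¹ ≤ (2 ^ b)⁻¹ := by
  rw [natCard_galoisField hb]
  have hy := two_le_two_pow hb
  generalize (2 : ℝ) ^ b = y at *
  have hy0 : 0 < y := by linarith
  calc n / y ^ 3 + (y ^ 2)⁻¹ ≤ y / y ^ 3 + (y ^ 2)⁻¹ := by gcongr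
    _ = 2 / y * y⁻¹ := by field_simp; norm_num
    _ ≤ 1 * y⁻¹ := by
        gcongr
        exact (div_le_one hy0).2 hy
    _ = y⁻¹ := one_mul _

/-- Here `6 = 3 + 2 + 1`: three for `|K|^k`, two for `a^n`, and one left over for the failure
probability. -/
theorem decay_pow_mul_le (hk : k ≤ n) (hb : 1 ≤ b) :
    ((2 ^ b : ℝ)⁻¹) ^ (6 * n) *
      ((Nat.card (GaloisField 2 (3 * b)) : ℝ) ^ k * ((2 ^ b : ℝ) ^ 2) ^ n) ≤ 2⁻¹ ^ n := by
  rw [natCard_galoisField hb]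
  have hy := two_le_two_pow hb
  generalize (2 : ℝ) ^ b = y at *
  have hy0 : 0 < y := by linarith
  calc (y⁻¹) ^ (6 * n) * ((y ^ 3) ^ k * (y ^ 2) ^ n)
      ≤ (y⁻¹) ^ (6 * n) * ((y ^ 3) ^ n * (y ^ 2) ^ n) := by
        gcongr
        exact one_le_pow₀ (by linarith)
    _ = (y⁻¹) ^ n := by
        rw [← pow_mul, ← pow_mul, ← pow_add, show 6 * n = n + (3 * n + 2 * n) by ring, pow_add,
          mul_assoc, ← mul_pow, inv_mul_cancel₀ hy0.ne', one_pow, mul_one]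
    _ ≤ 2⁻¹ ^ n := by gcongr

theorem exists_bijective_coin (n k : ℕ) (hb : 1 ≤ b) :
    ∃ f : Coin (n * (k * (3 * b))) → Fin n → Fin k → GaloisField 2 (3 * b),
      Function.Bijective f := by
  have := Fintype.ofFinite (GaloisField 2 (3 * b))
  refine ⟨_, (Fintype.equivOfCardEq ?_).bijective⟩
  simp only [Fintype.card_fun, Fintype.card_fin, Fintype.card_bool]
  rw [← Nat.card_eq_fintype_card, GaloisField.card 2 _ (by omega)]
  ring

end Parameters

end DynamicNetwork

open DynamicNetwork
theorem corollary8 :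
    -- randomized: `O(n)` rounds with probability at least `1 - 2^(-n)`
    (∃ c C : ℕ, ∀ n k d b T : ℕ, 1 ≤ n → k ≤ n → d ≤ b → 1 ≤ b → Real.logb 2 n ≤ b → 1 ≤ T →
      ∃ (s : ℕ) (A : CentralizedAlgorithm n k d (c * b) s),
        A.IsNetworkCoding ∧ A.IsLasVegas T ∧
        A.SolvesWithProb T (C * n) (1 - 2⁻¹ ^ n)) ∧
    -- order-optimality: every centralized algorithm needs at least `n - 1` rounds
    (∀ n k d m s T R : ℕ, 1 ≤ k → k ≤ n → 1 ≤ d → 1 ≤ T →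
      ∀ A : CentralizedAlgorithm n k d m s,
        A.SolvesWithProb T R (1 - 2⁻¹ ^ n) → n ≤ R + 1) ∧
    -- deterministic
    (∃ (c : ℕ) (C : ℝ), ∀ n k d b T : ℕ,
      1 ≤ n → k ≤ n → d ≤ b → 1 ≤ b → Real.logb 2 n ≤ b → 1 ≤ T →
      ∃ (A : CentralizedAlgorithm n k d (c * b) 0) (R : ℕ),
        A.IsNetworkCoding ∧ A.SolvesSurely T R ∧
        (R : ℝ) ≤ C * (Real.logb 2 n / (b * T) * n * min (k : ℝ) ((n : ℝ) / T) + n)) := by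
  refine ⟨⟨3, 6, ?_⟩, fun n k d m s T R hk _ hd _ A hA => hA.le_succ hk hd, 3, 6, ?_⟩
  · intro n k d b T hn hk hd hb hnb _
    obtain ⟨enc, emb, hemb⟩ := exists_embedding hb hd
    obtain ⟨f, hf⟩ := exists_bijective_coin n k hb
    have ha1 : (1 : ℝ) ≤ (2 ^ b) ^ 2 := one_le_pow₀ (by linarith [two_le_two_pow hb])
    have hρ := decay_le hb (le_two_pow hn hnb)
    have hle := decay_pow_mul_le hk hb
    have hlt : (2⁻¹ : ℝ) ^ n < 1 := pow_lt_one₀ (by norm_num) (by norm_num) (by omega)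
    -- The `6n` random rounds give the probability bound; `6n` derandomized rounds after them
    -- guarantee termination for every outcome.
    refine ⟨_, (mixedRule _ (by positivity) (6 * n) f).algorithm enc emb,
      Rule.algorithm_isNetworkCoding enc emb _, fun I adv hadv ω => ⟨_, solvedBy_mixedRule _ hemb
        ha1 hρ (hle.trans_lt hlt) I hadv ω⟩, fun I adv hadv => ?_⟩
    exact (sub_le_sub_left hle 1).trans
      (solvesWithProb_mixedRule _ hemb ha1 hρ hf T I adv hadv)
  · intro n k d b T hn hk hd hb hnb _
    obtain ⟨enc, emb, hemb⟩ := exists_embedding hb hd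
    have ha1 : (1 : ℝ) ≤ (2 ^ b) ^ 2 := one_le_pow₀ (by linarith [two_le_two_pow hb])
    have hρ := decay_le hb (le_two_pow hn hnb)
    have hle := decay_pow_mul_le hk hb
    have hlt : (2⁻¹ : ℝ) ^ n < 1 := pow_lt_one₀ (by norm_num) (by norm_num) (by omega)
    -- With no random rounds the coin reader is never consulted, so it may be constant.
    refine ⟨(mixedRule _ (by positivity) 0 fun _ _ => 0).algorithm enc emb, 0 + 6 * n,
      Rule.algorithm_isNetworkCoding enc emb _, fun I adv hadv ω => solvedBy_mixedRule _ hemb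
        ha1 hρ (hle.trans_lt hlt) I hadv ω, ?_⟩
    have hlog : 0 ≤ Real.logb 2 n := Real.logb_nonneg one_lt_two (by exact_mod_cast hn)
    have hmin : 0 ≤ min (k : ℝ) ((n : ℝ) / T) := by positivity
    have : 0 ≤ Real.logb 2 n / (b * T) * n * min (k : ℝ) ((n : ℝ) / T) := by positivity
    push_cast
    linarith
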